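/- For $(p,q,r)\in\mathbb C^3$ let $K(p,q,r)$ be the affine surface $$y^2=x(x+t^2)(x+t^3+pt^2+qt+r)$$ in $(x,y,t)$-space $\mathbb C^3$, let $K^{\circ}(p,q,r)$ be its smooth locus, and let $\omega=\dfrac{dx\wedge dt}{y}=\dfrac{dx\wedge dt}{\sqrt{x(x+t^2)(x+t^3+pt^2+qt+r)}}$ be the holomorphic $2$-form on $K^{\circ}(p,q,r)$ (for $(q,r)\neq(0,0)$ the surface $K(p,q,r)$ is a model of a Kummer surface, and $K^{\circ}(p,q,r)$ is an open subset of the latter). Then there are an open neighbourhood $U$ of the origin in $\mathbb C^3$, a constant $c\in\mathbb C\setminus\{0\}$, and a continuous family of smooth singular $2$-cycles $\Delta=\Delta_{(p,q,r)}$ with integer coefficients on $K^{\circ}(p,q,r)$, $(p,q,r)\in U$ (a fixed finite integral combination of singular squares that depend continuously on $(p,q,r)$), such that for every $(p,q,r)\in U$ $$\iint_{\Delta}\frac{dx\wedge dt}{\sqrt{x(x+t^2)(x+t^3+pt^2+qt+r)}} = c\sum_{\ell,m,n=0}^{\infty}\frac{1}{2^{4(\ell+2m+3n)}}\,\frac{\big((2(\ell+2m+3n))!\big)^2}{\big((\ell+2m+3n)!\big)^3}\,\frac{1}{\ell!\,m!\,n!\,(m+2n)!}\,p^{\ell}q^{m}r^{n},$$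 where the triple series converges absolutely. The constant $c$ does not depend on $(p,q,r)$. -/

import Mathlib

noncomputable section

namespace KummerPeriod

/-- The right-hand side `x (x + t²) (x + t³ + p t² + q t + r)` of the equation of `K(p,q,r)`. -/
def rhs (p q r x t : ℂ) : ℂ :=
  x * (x + t ^ 2) * (x + t ^ 3 + p * t ^ 2 + q * t + r)

/-- The partial derivative of the right-hand side with respect to `x`. -/
def rhsX (p q r x t : ℂ) : ℂ := deriv (fun x' => rhs p q r x' t) x

/-- The partial derivative of the right-hand side with respect to `t`. -/
def rhsT (p q r x t : ℂ) : ℂ := deriv (fun t' => rhs p q r x t') t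

/-- The smooth locus of the affine surface
`K(p,q,r) : y² = x (x + t²) (x + t³ + p t² + q t + r)`; its points are triples `(x, y, t)`.
The minimal resolution of a projective closure of the affine surface is an isomorphism over this
locus, so that it is an open subset of the smooth compact surface. -/
def surface (p q r : ℂ) : Set (ℂ × ℂ × ℂ) :=
  {P | P.2.1 ^ 2 = rhs p q r P.1 P.2.2 ∧
    ¬ (P.2.1 = 0 ∧ rhsX p q r P.1 P.2.2 = 0 ∧ rhsT p q r P.1 P.2.2 = 0)}

/-- The holomorphic 2-form `ω = dx ∧ dt / y` on the smooth locus, at the point `P = (x, y, t)`, on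
the tangent vectors `V` and `W`.  On the surface `2 y dy = f_x dx + f_t dt`, where `f` is the
right-hand side of the equation, so that `dx ∧ dt / y`, `2 dy ∧ dt / f_x` and `2 dx ∧ dy / f_t`
are the same form; at points with `y = 0` one of the last two expressions is used. -/
def omega (p q r : ℂ) (P V W : ℂ × ℂ × ℂ) : ℂ :=
  if P.2.1 ≠ 0 then
    (V.1 * W.2.2 - V.2.2 * W.1) / P.2.1
  else if rhsX p q r P.1 P.2.2 ≠ 0 then
    2 * (V.2.1 * W.2.2 - V.2.2 * W.2.1) / rhsX p q r P.1 P.2.2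
  else
    2 * (V.1 * W.2.1 - V.2.1 * W.1) / rhsT p q r P.1 P.2.2

/-- The three expressions for `ω` agree on tangent vectors of the smooth locus. -/
theorem omega_spec {p q r : ℂ} {P V W : ℂ × ℂ × ℂ} (hP : P ∈ surface p q r)
    (hV : 2 * P.2.1 * V.2.1 = rhsX p q r P.1 P.2.2 * V.1 + rhsT p q r P.1 P.2.2 * V.2.2)
    (hW : 2 * P.2.1 * W.2.1 = rhsX p q r P.1 P.2.2 * W.1 + rhsT p q r P.1 P.2.2 * W.2.2) :
    P.2.1 * omega p q r P V W = V.1 * W.2.2 - V.2.2 * W.1 ∧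
    rhsX p q r P.1 P.2.2 * omega p q r P V W = 2 * (V.2.1 * W.2.2 - V.2.2 * W.2.1) ∧
    rhsT p q r P.1 P.2.2 * omega p q r P V W = 2 * (V.1 * W.2.1 - V.2.1 * W.1) := by
  have hs := hP.2
  unfold omega
  generalize rhsX p q r P.1 P.2.2 = a at *
  generalize rhsT p q r P.1 P.2.2 = b at *
  by_cases hy : P.2.1 = 0
  · rw [hy] at hV hW
    by_cases ha : a = 0
    · have hb : b ≠ 0 := fun hb => hs ⟨hy, ha, hb⟩
      have h1 : V.2.2 = 0 := by simpa [ha, hb] using hV.symm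
      have h2 : W.2.2 = 0 := by simpa [ha, hb] using hW.symm
      simp only [hy, ha, h1, h2, ne_eq, not_true_eq_false, if_false]
      refine ⟨by ring, by ring, ?_⟩
      field_simp
    · simp only [hy, ha, ne_eq, not_true_eq_false, not_false_eq_true, if_false, if_true]
      have e1 : V.1 = -(b * V.2.2) / a := by
        field_simp; linear_combination -hV
      have e2 : W.1 = -(b * W.2.2) / a := by
        field_simp; linear_combination -hW
      rw [e1, e2]
      refine ⟨by field_simp; ring, by field_simp, by field_simp; ring⟩
  · simp only [hy, ne_eq, not_false_eq_true, if_true]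
    have e1 : V.2.1 = (a * V.1 + b * V.2.2) / (2 * P.2.1) := by
      field_simp; linear_combination hV
    have e2 : W.2.1 = (a * W.1 + b * W.2.2) / (2 * P.2.1) := by
      field_simp; linear_combination hW
    rw [e1, e2]
    refine ⟨by field_simp, by field_simp; ring, by field_simp; ring⟩

/-- The closed unit square `[0,1]²`. -/
def unitSquare : Set (ℝ × ℝ) := Set.Icc 0 1 ×ˢ Set.Icc 0 1

/-- A formal sum `∑ i, coeff i • cube i` of `k` singular squares in `(x, y, t)`-space with integer
coefficients.  Only the restriction of `cube i` to the unit square matters. -/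
structure SquareChain (k : ℕ) where
  coeff : Fin k → ℤ
  cube : Fin k → ℝ × ℝ → ℂ × ℂ × ℂ

/-- The boundary of a chain of singular squares, an element of the free abelian group on the maps
from the unit interval: `∂σ = σ(1,·) - σ(0,·) + σ(·,0) - σ(·,1)`. -/
def SquareChain.boundary {k : ℕ} (c : SquareChain k) : (unitInterval → ℂ × ℂ × ℂ) →₀ ℤ :=
  ∑ i, c.coeff i •
    (Finsupp.single (fun τ : unitInterval => c.cube i (1, (τ : ℝ))) 1
      - Finsupp.single (fun τ : unitInterval => c.cube i (0, (τ : ℝ))) 1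
      + Finsupp.single (fun τ : unitInterval => c.cube i ((τ : ℝ), 0)) 1
      - Finsupp.single (fun τ : unitInterval => c.cube i ((τ : ℝ), 1)) 1)

/-- The chain is a smooth singular 2-cycle of `X`, in the normalized cubical singular complex: its
squares are smooth maps of the closed square (restrictions of smooth maps of the plane) into `X`,
and its boundary is a combination of degenerate, that is constant, paths. -/
structure SquareChain.IsCycleOn {k : ℕ} (c : SquareChain k) (X : Set (ℂ × ℂ × ℂ)) : Prop where
  smooth : ∀ i, ContDiff ℝ ((⊤ : ℕ∞) : WithTop ℕ∞) (c.cube i)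
  mapsTo : ∀ i, Set.MapsTo (c.cube i) unitSquare X
  boundary_mem : c.boundary ∈ AddSubgroup.closure
    (Set.range fun P : ℂ × ℂ × ℂ => Finsupp.single (fun _ : unitInterval => P) (1 : ℤ))

/-- The integral of `ω` over a chain: the integral of the pullback of `ω` to the unit square,
summed over the squares with their coefficients. -/
def SquareChain.integral {k : ℕ} (c : SquareChain k) (p q r : ℂ) : ℂ :=
  ∑ i, (c.coeff i : ℂ) * ∫ z in unitSquare,
    omega p q r (c.cube i z) (fderiv ℝ (c.cube i) z (1, 0)) (fderiv ℝ (c.cube i) z (0, 1))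

/-- A continuous family, over a set `U` of parameters `s = (p, q, r)`, of 2-cycles `Δ s` on the
surfaces `K(p,q,r)`: the coefficients do not depend on `s`, and the squares are continuous in
`s` and in the variables of the square jointly.  (Its classes are transported into each other by
local trivializations of the family of surfaces.) -/
structure IsCycleFamily {k : ℕ} (U : Set (ℂ × ℂ × ℂ)) (Δ : ℂ × ℂ × ℂ → SquareChain k) :
    Prop where
  isCycle : ∀ s ∈ U, (Δ s).IsCycleOn (surface s.1 s.2.1 s.2.2)
  coeff_eq : ∀ s ∈ U, ∀ s' ∈ U, (Δ s).coeff = (Δ s').coeff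
  continuousOn : ∀ i, ContinuousOn
    (fun a : (ℂ × ℂ × ℂ) × (ℝ × ℝ) => (Δ a.1).cube i a.2) (U ×ˢ unitSquare)

/-- The coefficient of `p ^ l * q ^ m * r ^ n` in the power series, with `N = l + 2 m + 3 n`. -/
def seriesCoeff (l m n : ℕ) : ℂ :=
  1 / 2 ^ (4 * (l + 2 * m + 3 * n))
    * ((Nat.factorial (2 * (l + 2 * m + 3 * n)) : ℂ) ^ 2
      / (Nat.factorial (l + 2 * m + 3 * n) : ℂ) ^ 3)
    * (1 / ((Nat.factorial l : ℂ) * (Nat.factorial m : ℂ) * (Nat.factorial n : ℂ)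
      * (Nat.factorial (m + 2 * n) : ℂ)))

end KummerPeriod

end

/-!
With `x = t² u` the equation of the surface becomes `y² = t⁶ u² (1 + λ/u) (1 + u)`, where
`λ = t + p + q/t + r/t²`.  On the torus `|t| = 1/4`, `|u| = 1/2` and for small `(p, q, r)` one has
`|λ/u| < 1` and `|u| < 1`, so the principal square roots of `1 + λ/u` and `1 + u` single out a
branch of `y` that is smooth and does not vanish there.  The cycle is this torus, a single square
whose opposite sides agree.  It is the family over `|t| = 1/4` of the cycles in the elliptic fibres
that encircle the branch points `u = 0` and `u = -λ`.

In the angular coordinates of the torus `ω` is `4π² (1 + λ/u)^(-1/2) (1 + u)^(-1/2)`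
(`omega_torus`), so the period is `4π²` times the mean of this function.  Expanding both factors in
binomial series and the powers of `λ` by the multinomial theorem, and integrating term by term,
only monomials constant in `t` and in `u` contribute (`hasSum_integral_torus`).  Constancy in `u`
squares the binomial coefficient of index `N`, and constancy in `t` selects the terms
`t ^ (m + 2 n) * p ^ l * (q/t) ^ m * (r/t²) ^ n` with `N = l + 2 m + 3 n`; this is the triple
series (`seriesCoeff_eq`, `hasSum_series`).
-/

namespace KummerPeriod

/-! ### Multinomial expansion of power series -/

open Finset in
/-- Multinomial expansion of the sum over one fibre `∑ i, k i = n` of the space of exponents. -/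
theorem hasSum_multinomial_fiber {𝕜 ι : Type*} [NormedField 𝕜] [Fintype ι] [DecidableEq ι]
    (a : ℕ → 𝕜) (f : ι → 𝕜) (n : ℕ) :
    HasSum (fun k : {k : ι → ℕ // ∑ i, k i = n} =>
      a (∑ i, k.1 i) * Nat.multinomial univ k.1 * ∏ i, f i ^ k.1 i) (a n * (∑ i, f i) ^ n) := by
  have h := hasSum_sum_of_ne_finset_zero (L := .unconditional (ι → ℕ))
    (s := piAntidiag (univ : Finset ι) n) (f := Set.indicator {k : ι → ℕ | ∑ i, k i = n} fun k =>
      a (∑ i, k i) * Nat.multinomial univ k * ∏ i, f i ^ k i)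
    (by
      intro k hk
      refine Set.indicator_of_notMem (fun hk' => hk ?_) _
      simpa using hk')
  have h' : HasSum (fun k : {k : ι → ℕ // ∑ i, k i = n} =>
      a (∑ i, k.1 i) * Nat.multinomial univ k.1 * ∏ i, f i ^ k.1 i) _ :=
    hasSum_subtype_iff_indicator.2 h
  convert h' using 1
  rw [sum_pow_eq_sum_piAntidiag, mul_sum]
  refine sum_congr rfl fun k hk => ?_
  have hk' : ∑ i, k i = n := by simpa using hk
  rw [Set.indicator_of_mem (show k ∈ {k : ι → ℕ | ∑ i, k i = n} from hk'), hk', mul_assoc]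

open Finset in
theorem summable_norm_multinomial {ι : Type*} [Fintype ι] [DecidableEq ι]
    {a : ℕ → ℂ} {f : ι → ℂ} (h : Summable fun n => ‖a n‖ * (∑ i, ‖f i‖) ^ n) :
    Summable fun k : ι → ℕ => ‖a (∑ i, k i) * Nat.multinomial univ k * ∏ i, f i ^ k i‖ := by
  rw [← (Equiv.sigmaFiberEquiv fun k : ι → ℕ => ∑ i, k i).summable_iff,
    summable_sigma_of_nonneg fun _ => by simp only [Function.comp_apply]; positivity]
  have key (n : ℕ) := hasSum_multinomial_fiber (fun n => ‖a n‖) (fun i => ‖f i‖) n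
  have e (k : ι → ℕ) : ‖a (∑ i, k i) * Nat.multinomial univ k * ∏ i, f i ^ k i‖ =
      ‖a (∑ i, k i)‖ * Nat.multinomial univ k * ∏ i, ‖f i‖ ^ k i := by
    simp [norm_prod]
  simp only [Function.comp_def, Equiv.sigmaFiberEquiv_apply, e]
  exact ⟨fun n => (key n).summable, by simpa only [(key _).tsum_eq] using h⟩

open Finset in
/-- A power series in `∑ i, f i`, expanded by the multinomial theorem. -/
theorem hasSum_multinomial {ι : Type*} [Fintype ι] [DecidableEq ι]
    {a : ℕ → ℂ} {f : ι → ℂ} {S : ℂ} (h : Summable fun n => ‖a n‖ * (∑ i, ‖f i‖) ^ n)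
    (hS : HasSum (fun n => a n * (∑ i, f i) ^ n) S) :
    HasSum (fun k : ι → ℕ => a (∑ i, k i) * Nat.multinomial univ k * ∏ i, f i ^ k i) S := by
  rw [← (Equiv.sigmaFiberEquiv fun k : ι → ℕ => ∑ i, k i).hasSum_iff]
  refine HasSum.sigma_of_hasSum hS (fun n => hasSum_multinomial_fiber a f n) ?_
  exact (Equiv.summable_iff _).2 (summable_norm_multinomial h).of_norm

/-! ### The binomial series with exponent -1/2 -/

/-- The coefficients of the binomial series of `(1 + x) ^ (-1/2)`. -/
noncomputable def invSqrtCoeff (n : ℕ) : ℂ := Ring.choose (-1 / 2 : ℂ) n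

/-- Division-free form of `invSqrtCoeff n = (-1)ⁿ (2n)! / (4ⁿ n!²)`. -/
theorem invSqrtCoeff_mul (n : ℕ) :
    invSqrtCoeff n * (4 ^ n * (n.factorial : ℂ) ^ 2) = (-1) ^ n * ((2 * n).factorial : ℂ) := by
  have hd (n : ℕ) : (n.factorial : ℂ) * invSqrtCoeff n = (descPochhammer ℤ n).smeval (-1 / 2 : ℂ) := by
    rw [Ring.descPochhammer_eq_factorial_smul_choose, nsmul_eq_mul, invSqrtCoeff]
  have hs (n : ℕ) : ((n + 1).factorial : ℂ) * invSqrtCoeff (n + 1) =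
      n.factorial * invSqrtCoeff n * (-1 / 2 - n) := by
    rw [hd, hd, descPochhammer_succ_right, Polynomial.smeval_mul]
    simp [Polynomial.smeval_natCast]
  induction n with
  | zero => simp [invSqrtCoeff]
  | succ n ih =>
    have h1 := hs n
    have e : ((2 * (n + 1)).factorial : ℂ) = (2 * n + 2) * (2 * n + 1) * (2 * n).factorial := by
      rw [show 2 * (n + 1) = 2 * n + 1 + 1 by ring, Nat.factorial_succ, Nat.factorial_succ]
      push_cast; ring
    have e2 : ((n + 1).factorial : ℂ) = (n + 1) * n.factorial := by
      rw [Nat.factorial_succ]; push_cast; ring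
    rw [e]
    linear_combination (4 ^ (n + 1) * ((n + 1).factorial : ℂ)) * h1 +
      4 ^ (n + 1) * n.factorial * invSqrtCoeff n * (-1 / 2 - n) * e2
      - (2 * n + 2) * (2 * n + 1) * ih

theorem hasSum_invSqrtCoeff {x : ℂ} (hx : ‖x‖ < 1) :
    HasSum (fun n => invSqrtCoeff n * x ^ n) ((1 + x) ^ (-1 / 2 : ℂ)) := by
  have h := (Complex.one_add_cpow_hasFPowerSeriesOnBall_zero (a := -1 / 2)).hasSum
    (y := x) (by simpa [Metric.mem_eball, edist_zero_right, enorm_eq_nnnorm, ← NNReal.coe_lt_coe] using hx)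
  simp only [zero_add, binomialSeries_apply, List.ofFn_const, List.prod_replicate, smul_eq_mul] at h
  exact h

theorem summable_norm_invSqrtCoeff {ρ : ℝ} (h0 : 0 ≤ ρ) (h1 : ρ < 1) :
    Summable fun n => ‖invSqrtCoeff n‖ * ρ ^ n := by
  have h := (hasSum_invSqrtCoeff (x := (ρ : ℂ)) (by simpa [abs_of_nonneg h0] using h1)).summable.norm
  simpa [abs_of_nonneg h0] using h

/-! ### Fourier monomials on the circle -/

open Complex in
/-- The standard parametrization `s ↦ exp (2πi s)` of the unit circle. -/
noncomputable def circ (s : ℝ) : ℂ := exp (2 * Real.pi * I * s)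

theorem circ_ne_zero (s : ℝ) : circ s ≠ 0 := Complex.exp_ne_zero _

@[simp] theorem norm_circ (s : ℝ) : ‖circ s‖ = 1 := by
  rw [circ, show 2 * (Real.pi : ℂ) * Complex.I * s = ((2 * Real.pi * s : ℝ) : ℂ) * Complex.I by
    push_cast; ring, Complex.norm_exp_ofReal_mul_I]

@[simp] theorem circ_zero : circ 0 = 1 := by simp [circ]

@[simp] theorem circ_one : circ 1 = 1 := by simp [circ]

theorem hasDerivAt_circ (s : ℝ) : HasDerivAt circ (2 * Real.pi * Complex.I * circ s) s := by
  have h : HasDerivAt (fun s : ℝ => 2 * Real.pi * Complex.I * (s : ℂ))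
      (2 * Real.pi * Complex.I) s := by
    simpa using (Complex.ofRealCLM.hasDerivAt (x := s)).const_mul (2 * Real.pi * Complex.I)
  rw [mul_comm]
  exact h.cexp

theorem contDiff_circ {n : WithTop ℕ∞} : ContDiff ℝ n circ := by
  unfold circ
  have : ContDiff ℝ n (fun s : ℝ => (s : ℂ)) := Complex.ofRealCLM.contDiff
  fun_prop

theorem continuous_circ : Continuous circ := (contDiff_circ (n := 0)).continuous

theorem integral_circ_zpow (n : ℤ) :
    ∫ s in Set.Icc (0 : ℝ) 1, circ s ^ n = if n = 0 then 1 else 0 := by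
  split_ifs with h
  · simp [h]
  · have hc : 2 * Real.pi * Complex.I * n ≠ 0 := by
      simp [Real.pi_ne_zero, h]
    have e (s : ℝ) : circ s ^ n = Complex.exp (2 * Real.pi * Complex.I * n * s) := by
      rw [circ, ← Complex.exp_int_mul]; ring_nf
    simp_rw [e]
    rw [MeasureTheory.integral_Icc_eq_integral_Ioc,
      ← intervalIntegral.integral_of_le zero_le_one, integral_exp_mul_complex hc]
    have : Complex.exp (2 * Real.pi * Complex.I * n) = 1 := by
      rw [show 2 * Real.pi * Complex.I * n = n * (2 * Real.pi * Complex.I) by ring]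
      exact Complex.exp_int_mul_two_pi_mul_I n
    simp [this]

/-! ### Means over the torus -/

theorem hasSum_mul_of_summable_norm {α β : Type*} {G : α → ℂ} {H : β → ℂ} {S T : ℂ}
    (hG : Summable fun x => ‖G x‖) (hH : Summable fun x => ‖H x‖) (hS : HasSum G S)
    (hT : HasSum H T) : HasSum (fun x : α × β => G x.1 * H x.2) (S * T) :=
  hS.mul hT (summable_mul_of_summable_norm hG hH)

open Finset in
/-- Expansion of the integrand of `hasSum_integral_torus` into monomials in `circ s`, `circ v`. -/
theorem hasSum_torus_integrand {ι : Type*} [Fintype ι] [DecidableEq ι] (w : ι → ℂ) (e : ι → ℤ)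
    (hw2 : ∑ i, ‖2 * w i‖ < 1) (s v : ℝ) :
    HasSum (fun x : (ι → ℕ) × ℕ =>
        (invSqrtCoeff (∑ i, x.1 i) * Nat.multinomial univ x.1 * ∏ i, (2 * w i) ^ x.1 i) *
          (invSqrtCoeff x.2 * (1 / 2) ^ x.2) *
          (circ s ^ (∑ i, e i * x.1 i) * circ v ^ ((x.2 : ℤ) - ∑ i, (x.1 i : ℤ))))
      ((1 + (∑ i, w i * circ s ^ e i) / (circ v / 2)) ^ (-1 / 2 : ℂ) *
          (1 + circ v / 2) ^ (-1 / 2 : ℂ)) := by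
  let f : ι → ℂ := fun i => 2 * w i * circ s ^ e i * (circ v)⁻¹
  have hfn : ∑ i, ‖f i‖ < 1 := by simpa [f] using hw2
  have hf : (∑ i, w i * circ s ^ e i) / (circ v / 2) = ∑ i, f i := by
    rw [sum_div]
    refine sum_congr rfl fun i _ => ?_
    have := circ_ne_zero v
    simp only [f]; field_simp
  have hsA := summable_norm_invSqrtCoeff (sum_nonneg fun _ _ => norm_nonneg _) hfn
  have H1 := hasSum_multinomial (f := f) hsA
    (hasSum_invSqrtCoeff ((norm_sum_le _ _).trans_lt hfn))
  have H2 := hasSum_invSqrtCoeff (x := circ v / 2) (by simp; norm_num)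
  have hG := summable_norm_multinomial hsA
  have H3 := hasSum_mul_of_summable_norm hG H2.summable.norm H1 H2
  rw [hf]
  convert H3 using 2 with x
  have hp : ∏ i, f i ^ x.1 i = (∏ i, (2 * w i) ^ x.1 i) *
      (circ s ^ (∑ i, e i * x.1 i) * (circ v ^ (∑ i, x.1 i))⁻¹) := by
    have hz : ∀ T : Finset ι, circ s ^ (∑ i ∈ T, e i * x.1 i) =
        ∏ i ∈ T, (circ s ^ e i) ^ x.1 i := by
      intro T
      induction T using Finset.induction_on with
      | empty => simp
      | insert j s hj ih =>
        rw [sum_insert hj, prod_insert hj, zpow_add₀ (circ_ne_zero _), ih, zpow_mul, zpow_natCast]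
    rw [hz, ← prod_pow_eq_pow_sum, ← prod_inv_distrib, ← prod_mul_distrib, ← prod_mul_distrib]
    refine prod_congr rfl fun i _ => ?_
    simp only [f, mul_pow, inv_pow]; ring
  have hu : circ v ^ ((x.2 : ℤ) - ∑ i, (x.1 i : ℤ)) =
      circ v ^ x.2 * (circ v ^ (∑ i, x.1 i))⁻¹ := by
    rw [zpow_sub₀ (circ_ne_zero _), ← Nat.cast_sum, zpow_natCast, zpow_natCast, div_eq_mul_inv]
  simp only [hu, hp, div_pow, one_div, inv_pow]
  ring

open Finset MeasureTheory in
/-- The mean over the torus `|u| = 1/2`, `|t| = 1` of `(1 + λ/u)^(-1/2) (1 + u)^(-1/2)`, where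
`λ = ∑ i, w i * t ^ e i` is a Laurent polynomial in `t`: in the expansion in monomials of `t` and
`u` only the constant terms survive, which are those with equal exponents in the two binomial
series and with trivial exponent of `t` in the multinomial expansion of the powers of `λ`. -/
theorem hasSum_integral_torus {ι : Type*} [Fintype ι] [DecidableEq ι] (w : ι → ℂ) (e : ι → ℤ)
    (hw : ∑ i, ‖w i‖ < 1 / 2) :
    HasSum (fun k : ι → ℕ => if ∑ i, e i * k i = 0 then
        invSqrtCoeff (∑ i, k i) ^ 2 * Nat.multinomial univ k * ∏ i, w i ^ k i else 0)
      (∫ z in unitSquare,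
        (1 + (∑ i, w i * circ z.1 ^ e i) / (circ z.2 / 2)) ^ (-1 / 2 : ℂ) *
          (1 + circ z.2 / 2) ^ (-1 / 2 : ℂ)) := by
  -- `A` and `B` are the coefficients of the two series; the radius `1/2` of the circle of `u`
  -- enters as a factor `2` in the terms of `λ/u` and `1/2` in `u`.
  let A : (ι → ℕ) → ℂ := fun k =>
    invSqrtCoeff (∑ i, k i) * Nat.multinomial univ k * ∏ i, (2 * w i) ^ k i
  let B : ℕ → ℂ := fun M => invSqrtCoeff M * (1 / 2) ^ M
  let F : (ι → ℕ) × ℕ → ℝ × ℝ → ℂ := fun x z =>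
    A x.1 * B x.2 * (circ z.1 ^ (∑ i, e i * x.1 i) * circ z.2 ^ ((x.2 : ℤ) - ∑ i, (x.1 i : ℤ)))
  have hw2 : ∑ i, ‖2 * w i‖ < 1 := by
    simp only [norm_mul, ← mul_sum]
    norm_num
    linarith
  have hA : Summable fun k => ‖A k‖ := summable_norm_multinomial
    (summable_norm_invSqrtCoeff (sum_nonneg fun _ _ => norm_nonneg _) hw2)
  have hB : Summable fun M => ‖B M‖ := by
    simpa [B] using summable_norm_invSqrtCoeff (ρ := 1 / 2) (by norm_num) (by norm_num)
  have hAB : Summable fun x : (ι → ℕ) × ℕ => ‖A x.1 * B x.2‖ :=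
    hA.mul_norm hB
  have hvol : (volume.restrict unitSquare : Measure (ℝ × ℝ)) Set.univ = 1 := by
    rw [Measure.restrict_apply_univ, unitSquare, Measure.volume_eq_prod, Measure.prod_prod]
    simp
  have hfin : IsFiniteMeasure (volume.restrict unitSquare : Measure (ℝ × ℝ)) :=
    ⟨by rw [hvol]; exact ENNReal.one_lt_top⟩
  have hFnorm (x : (ι → ℕ) × ℕ) (z : ℝ × ℝ) : ‖F x z‖ = ‖A x.1 * B x.2‖ := by
    simp [F]
  have hFcont (x : (ι → ℕ) × ℕ) : Continuous (F x) := by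
    have h1 : Continuous fun z : ℝ × ℝ => circ z.1 := continuous_circ.comp continuous_fst
    have h2 : Continuous fun z : ℝ × ℝ => circ z.2 := continuous_circ.comp continuous_snd
    exact continuous_const.mul ((h1.zpow₀ _ fun z => Or.inl (circ_ne_zero _)).mul
      (h2.zpow₀ _ fun z => Or.inl (circ_ne_zero _)))
  have hFint (x : (ι → ℕ) × ℕ) : Integrable (F x) (volume.restrict unitSquare) :=
    Integrable.of_bound (hFcont x).aestronglyMeasurable ‖A x.1 * B x.2‖
      (Filter.Eventually.of_forall fun z => (hFnorm x z).le)
  have hsum := hasSum_integral_of_summable_integral_norm hFint (by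
    simpa [hFnorm, Measure.real, hvol] using hAB)
  have hpt (z : ℝ × ℝ) : ∑' x, F x z =
      (1 + (∑ i, w i * circ z.1 ^ e i) / (circ z.2 / 2)) ^ (-1 / 2 : ℂ) *
          (1 + circ z.2 / 2) ^ (-1 / 2 : ℂ) :=
    (hasSum_torus_integrand w e hw2 z.1 z.2).tsum_eq
  have hval (x : (ι → ℕ) × ℕ) : ∫ z in unitSquare, F x z =
      if ∑ i, e i * x.1 i = 0 ∧ x.2 = ∑ i, x.1 i then A x.1 * B x.2 else 0 := by
    simp only [F]
    rw [integral_const_mul, unitSquare, Measure.volume_eq_prod,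
      setIntegral_prod_mul (fun s => circ s ^ (∑ i, e i * x.1 i))
        (fun s => circ s ^ ((x.2 : ℤ) - ∑ i, (x.1 i : ℤ))),
      integral_circ_zpow, integral_circ_zpow]
    have : (x.2 : ℤ) - ∑ i, (x.1 i : ℤ) = 0 ↔ x.2 = ∑ i, x.1 i := by
      rw [sub_eq_zero, ← Nat.cast_sum, Nat.cast_inj]
    simp only [this]
    split_ifs <;> simp_all
  simp only [hpt, hval] at hsum
  have hinj : Function.Injective fun k : ι → ℕ => (k, ∑ i, k i) := fun k k' h => (Prod.ext_iff.1 h).1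
  rw [← hinj.hasSum_iff] at hsum
  · refine Eq.mp (congrArg (HasSum · _) (funext fun k => ?_)) hsum
    simp only [Function.comp, and_true]
    refine if_congr Iff.rfl ?_ rfl
    simp only [A, B, mul_pow, prod_mul_distrib, prod_pow_eq_pow_sum]
    have : (2 : ℂ) ^ (∑ i, k i) * (1 / 2) ^ (∑ i, k i) = 1 := by
      rw [← mul_pow]; norm_num
    linear_combination ((invSqrtCoeff (∑ i, k i) ^ 2 * Nat.multinomial univ k *
      ∏ i, w i ^ k i)) * this
  · rintro ⟨k, M⟩ hx
    refine if_neg fun h => hx ⟨k, ?_⟩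
    simp [← h.2]

/-! ### The coefficients of the period -/

/-- The coefficient of `p ^ l * q ^ m * r ^ n` is `((1/2)_N / N!)²` times the multinomial
coefficient of the constant term of `(t + p + q/t + r/t²) ^ N`, `N = l + 2 m + 3 n`. -/
theorem seriesCoeff_eq (l m n : ℕ) :
    seriesCoeff l m n = invSqrtCoeff (∑ i, ![m + 2 * n, l, m, n] i) ^ 2 *
      Nat.multinomial Finset.univ ![m + 2 * n, l, m, n] := by
  have hN : ∑ i, ![m + 2 * n, l, m, n] i = l + 2 * m + 3 * n := by
    simp [Fin.sum_univ_four]; ring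
  have hm := Nat.multinomial_spec (Finset.univ : Finset (Fin 4)) ![m + 2 * n, l, m, n]
  rw [hN] at hm ⊢
  simp only [Fin.prod_univ_four, Matrix.cons_val] at hm
  have ha := invSqrtCoeff_mul (l + 2 * m + 3 * n)
  unfold seriesCoeff
  generalize l + 2 * m + 3 * n = N at *
  have hmC := congrArg (Nat.cast : ℕ → ℂ) hm
  push_cast at hmC
  have f1 : ∀ j : ℕ, (j.factorial : ℂ) ≠ 0 := fun j => Nat.cast_ne_zero.2 j.factorial_ne_zero
  have hM : (Nat.multinomial Finset.univ ![m + 2 * n, l, m, n] : ℂ) =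
      N.factorial / (l.factorial * m.factorial * n.factorial * (m + 2 * n).factorial) := by
    rw [eq_div_iff (by simp [f1])]
    linear_combination hmC
  have hs : ((-1 : ℂ) ^ N) ^ 2 = 1 := by rw [← pow_mul, mul_comm, pow_mul]; norm_num
  have hA : invSqrtCoeff N ^ 2 =
      ((2 * N).factorial : ℂ) ^ 2 / (2 ^ (4 * N) * (N.factorial : ℂ) ^ 4) := by
    rw [eq_div_iff (by simp [f1])]
    have h4 : (2 : ℂ) ^ (4 * N) = (4 ^ N) ^ 2 := by
      rw [← pow_mul, mul_comm N 2, show 4 * N = 2 * (2 * N) by ring, pow_mul]; norm_num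
    rw [h4]
    linear_combination (invSqrtCoeff N * (4 ^ N * (N.factorial : ℂ) ^ 2) +
      (-1) ^ N * ((2 * N).factorial : ℂ)) * ha + ((2 * N).factorial : ℂ) ^ 2 * hs
  rw [hM, hA]
  have := f1 l; have := f1 m; have := f1 n; have := f1 (m + 2 * n)
  field_simp

/-! ### The torus on the surface -/

/-- With `x = t² u` the surface becomes `y² = t⁶ u² (1 + λ/u) (1 + u)`, where `λ` is this Laurent
polynomial in `t`. -/
noncomputable def lam (p q r t : ℂ) : ℂ := t + p + q / t + r / t ^ 2

/-- The point of `K(p,q,r)` with coordinates `t` and `u = x / t²`, on the branch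
`y = t³ u (1 + λ/u)^(1/2) (1 + u)^(1/2)` given by the principal square roots. -/
noncomputable def branch (p q r t u : ℂ) : ℂ × ℂ × ℂ :=
  (t ^ 2 * u,
    t ^ 3 * u * ((1 + lam p q r t / u) ^ (1 / 2 : ℂ) * (1 + u) ^ (1 / 2 : ℂ)), t)

/-- The torus `|t| = 1/4`, `|u| = 1/2` on the surface, as a single singular square. -/
noncomputable def torus (p q r : ℂ) (z : ℝ × ℝ) : ℂ × ℂ × ℂ :=
  branch p q r (circ z.1 / 4) (circ z.2 / 2)

/-- The parameters for which `|λ| < 1/2` on the circle `|t| = 1/4`. -/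
def smallParams : Set (ℂ × ℂ × ℂ) := {s | ‖s.1‖ + 4 * ‖s.2.1‖ + 16 * ‖s.2.2‖ < 1 / 4}

theorem isOpen_smallParams : IsOpen smallParams :=
  isOpen_lt (by fun_prop) continuous_const

theorem norm_lam_div_lt {p q r : ℂ} (h : (p, q, r) ∈ smallParams) (z : ℝ × ℝ) :
    ‖lam p q r (circ z.1 / 4) / (circ z.2 / 2)‖ < 1 := by
  have h' : ‖p‖ + 4 * ‖q‖ + 16 * ‖r‖ < 1 / 4 := h
  have h1 : ‖lam p q r (circ z.1 / 4)‖ ≤ 1 / 4 + ‖p‖ + 4 * ‖q‖ + 16 * ‖r‖ := by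
    refine (norm_add_le _ _).trans (add_le_add ((norm_add_le _ _).trans
      (add_le_add ((norm_add_le _ _).trans (add_le_add ?_ le_rfl)) ?_)) ?_)
    · simp
    · simp [div_div_eq_mul_div, mul_comm]
    · simp [div_pow, div_div_eq_mul_div, mul_comm]; norm_num
  rw [norm_div, norm_div, norm_circ, div_lt_iff₀ (by simp)]
  norm_num
  linarith

theorem one_add_mem_slitPlane {x : ℂ} (h : ‖x‖ < 1) : 1 + x ∈ Complex.slitPlane :=
  Complex.mem_slitPlane_of_norm_lt_one h

theorem norm_circ_div_two_lt (s : ℝ) : ‖circ s / 2‖ < 1 := by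
  simp; norm_num

theorem torus_mem_surface {p q r : ℂ} (h : (p, q, r) ∈ smallParams) (z : ℝ × ℝ) :
    torus p q r z ∈ surface p q r ∧ (torus p q r z).2.1 ≠ 0 := by
  have h1 := Complex.slitPlane_ne_zero (one_add_mem_slitPlane (norm_lam_div_lt h z))
  have h2 := Complex.slitPlane_ne_zero (one_add_mem_slitPlane (norm_circ_div_two_lt z.2))
  have ht : circ z.1 / 4 ≠ 0 := div_ne_zero (circ_ne_zero _) (by norm_num)
  have hu : circ z.2 / 2 ≠ 0 := div_ne_zero (circ_ne_zero _) (by norm_num)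
  have sq (w : ℂ) : (w ^ (1 / 2 : ℂ)) ^ 2 = w := by
    simp
  have hy : (torus p q r z).2.1 ≠ 0 := by
    simp only [torus, branch]
    refine mul_ne_zero (mul_ne_zero (pow_ne_zero _ ht) hu) (mul_ne_zero ?_ ?_)
    · simp [Complex.cpow_eq_zero_iff, h1]
    · simp [Complex.cpow_eq_zero_iff, h2]
  refine ⟨⟨?_, fun h0 => hy h0.1⟩, hy⟩
  simp only [torus, branch, mul_pow, sq]
  generalize circ z.1 / 4 = t at *
  generalize circ z.2 / 2 = u at *
  simp only [lam, rhs]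
  field_simp
  ring

theorem contDiff_torus {p q r : ℂ} (h : (p, q, r) ∈ smallParams) :
    ContDiff ℝ ((⊤ : ℕ∞) : WithTop ℕ∞) (torus p q r) := by
  have hsq {f : ℝ × ℝ → ℂ} (hf : ContDiff ℝ ((⊤ : ℕ∞) : WithTop ℕ∞) f)
      (h0 : ∀ z, f z ∈ Complex.slitPlane) :
      ContDiff ℝ ((⊤ : ℕ∞) : WithTop ℕ∞) fun z => f z ^ (1 / 2 : ℂ) := by
    refine contDiff_iff_contDiffAt.2 fun z => ?_
    have : AnalyticAt ℂ (fun w : ℂ => w ^ (1 / 2 : ℂ)) (f z) :=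
      analyticAt_id.cpow analyticAt_const (h0 z)
    exact (this.contDiffAt.restrict_scalars ℝ).comp z hf.contDiffAt
  have hdiv {f g : ℝ × ℝ → ℂ} (hf : ContDiff ℝ ((⊤ : ℕ∞) : WithTop ℕ∞) f)
      (hg : ContDiff ℝ ((⊤ : ℕ∞) : WithTop ℕ∞) g) (h0 : ∀ z, g z ≠ 0) :
      ContDiff ℝ ((⊤ : ℕ∞) : WithTop ℕ∞) fun z => f z / g z := by
    simp only [div_eq_mul_inv]
    exact hf.mul (hg.inv h0)
  have ht : ContDiff ℝ ((⊤ : ℕ∞) : WithTop ℕ∞) fun z : ℝ × ℝ => circ z.1 / 4 :=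
    (contDiff_circ.comp contDiff_fst).div_const 4
  have hu : ContDiff ℝ ((⊤ : ℕ∞) : WithTop ℕ∞) fun z : ℝ × ℝ => circ z.2 / 2 :=
    (contDiff_circ.comp contDiff_snd).div_const 2
  have ht0 (z : ℝ × ℝ) : circ z.1 / 4 ≠ 0 := div_ne_zero (circ_ne_zero _) (by norm_num)
  have hu0 (z : ℝ × ℝ) : circ z.2 / 2 ≠ 0 := div_ne_zero (circ_ne_zero _) (by norm_num)
  have hl : ContDiff ℝ ((⊤ : ℕ∞) : WithTop ℕ∞)
      fun z : ℝ × ℝ => lam p q r (circ z.1 / 4) / (circ z.2 / 2) :=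
    hdiv (((ht.add contDiff_const).add (hdiv contDiff_const ht ht0)).add
      (hdiv contDiff_const (ht.pow 2) fun z => pow_ne_zero _ (ht0 z))) hu hu0
  exact ((ht.pow 2).mul hu).prodMk ((((ht.pow 3).mul hu).mul
    ((hsq (contDiff_const.add hl) fun z => one_add_mem_slitPlane (norm_lam_div_lt h z)).mul
      (hsq (contDiff_const.add hu)
        fun z => one_add_mem_slitPlane (norm_circ_div_two_lt z.2)))).prodMk ht)

theorem continuousOn_torus : ContinuousOn
    (fun a : (ℂ × ℂ × ℂ) × (ℝ × ℝ) => torus a.1.1 a.1.2.1 a.1.2.2 a.2)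
    (smallParams ×ˢ unitSquare) := by
  rintro ⟨⟨p, q, r⟩, z⟩ ⟨hs, -⟩
  refine ContinuousAt.continuousWithinAt ?_
  have ht : ContinuousAt (fun a : (ℂ × ℂ × ℂ) × (ℝ × ℝ) => circ a.2.1 / 4) ((p, q, r), z) :=
    ((continuous_circ.comp (continuous_fst.comp continuous_snd)).div_const 4).continuousAt
  have hu : ContinuousAt (fun a : (ℂ × ℂ × ℂ) × (ℝ × ℝ) => circ a.2.2 / 2) ((p, q, r), z) :=
    ((continuous_circ.comp (continuous_snd.comp continuous_snd)).div_const 2).continuousAt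
  have ht0 : circ z.1 / 4 ≠ 0 := div_ne_zero (circ_ne_zero _) (by norm_num)
  have hu0 : circ z.2 / 2 ≠ 0 := div_ne_zero (circ_ne_zero _) (by norm_num)
  have hl : ContinuousAt (fun a : (ℂ × ℂ × ℂ) × (ℝ × ℝ) =>
      lam a.1.1 a.1.2.1 a.1.2.2 (circ a.2.1 / 4) / (circ a.2.2 / 2)) ((p, q, r), z) := by
    refine ContinuousAt.div (((ht.add ?_).add (ContinuousAt.div ?_ ht ht0)).add
      (ContinuousAt.div ?_ (ht.pow 2) (pow_ne_zero _ ht0))) hu hu0 <;> fun_prop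
  exact ((ht.pow 2).mul hu).prodMk ((((ht.pow 3).mul hu).mul
    (((continuousAt_const.add hl).cpow continuousAt_const
        (one_add_mem_slitPlane (norm_lam_div_lt hs z))).mul
      ((continuousAt_const.add hu).cpow continuousAt_const
        (one_add_mem_slitPlane (norm_circ_div_two_lt z.2))))).prodMk ht)

/-! ### The period -/

/-- The pullback of `ω` to the torus: `dx ∧ dt / y = - t² du ∧ dt / y`, and `dt = 2πi t ds`,
`du = 2πi u dv` in the coordinates `(s, v)` of the square. -/
theorem omega_torus {p q r : ℂ} (h : (p, q, r) ∈ smallParams) (z : ℝ × ℝ) :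
    omega p q r (torus p q r z) (fderiv ℝ (torus p q r) z (1, 0))
        (fderiv ℝ (torus p q r) z (0, 1)) =
      4 * Real.pi ^ 2 *
        ((1 + lam p q r (circ z.1 / 4) / (circ z.2 / 2)) ^ (-1 / 2 : ℂ) *
          (1 + circ z.2 / 2) ^ (-1 / 2 : ℂ)) := by
  have hy := (torus_mem_surface h z).2
  have hd : HasFDerivAt (torus p q r) (fderiv ℝ (torus p q r) z) z :=
    ((contDiff_torus h).differentiable (by simp) z).hasFDerivAt
  have hV : HasDerivAt (fun s => torus p q r (s, z.2)) (fderiv ℝ (torus p q r) z (1, 0)) z.1 :=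
    HasFDerivAt.comp_hasDerivAt (f := fun s => (s, z.2)) z.1 hd ((hasDerivAt_id z.1).prodMk (hasDerivAt_const z.1 z.2))
  have hW : HasDerivAt (fun v => torus p q r (z.1, v)) (fderiv ℝ (torus p q r) z (0, 1)) z.2 :=
    HasFDerivAt.comp_hasDerivAt (f := fun v => (z.1, v)) z.2 hd ((hasDerivAt_const z.2 z.1).prodMk (hasDerivAt_id z.2))
  have fst_deriv {f : ℝ → ℂ × ℂ × ℂ} {f' : ℂ × ℂ × ℂ} {x : ℝ} (hf : HasDerivAt f f' x) :
      HasDerivAt (fun y => (f y).1) f'.1 x :=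
    (ContinuousLinearMap.fst ℝ ℂ (ℂ × ℂ)).hasFDerivAt.comp_hasDerivAt x hf
  have trd_deriv {f : ℝ → ℂ × ℂ × ℂ} {f' : ℂ × ℂ × ℂ} {x : ℝ} (hf : HasDerivAt f f' x) :
      HasDerivAt (fun y => (f y).2.2) f'.2.2 x :=
    ((ContinuousLinearMap.snd ℝ ℂ ℂ).comp
      (ContinuousLinearMap.snd ℝ ℂ (ℂ × ℂ))).hasFDerivAt.comp_hasDerivAt x hf
  have ht : HasDerivAt (fun s => circ s / 4) (2 * Real.pi * Complex.I * circ z.1 / 4) z.1 :=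
    (hasDerivAt_circ z.1).div_const 4
  have hu : HasDerivAt (fun s => circ s / 2) (2 * Real.pi * Complex.I * circ z.2 / 2) z.2 :=
    (hasDerivAt_circ z.2).div_const 2
  have eV3 : (fderiv ℝ (torus p q r) z (1, 0)).2.2 = 2 * Real.pi * Complex.I * circ z.1 / 4 :=
    (trd_deriv hV).unique ht
  have eW3 : (fderiv ℝ (torus p q r) z (0, 1)).2.2 = 0 :=
    (trd_deriv hW).unique (hasDerivAt_const z.2 (circ z.1 / 4))
  have eW1 : (fderiv ℝ (torus p q r) z (0, 1)).1 =
      (circ z.1 / 4) ^ 2 * (2 * Real.pi * Complex.I * circ z.2 / 2) :=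
    (fst_deriv hW).unique (hu.const_mul ((circ z.1 / 4) ^ 2))
  rw [omega, if_pos hy, eV3, eW3, eW1]
  rw [neg_div, Complex.cpow_neg, Complex.cpow_neg]
  simp only [torus, branch] at hy ⊢
  have hc1 := circ_ne_zero z.1
  have hc2 := circ_ne_zero z.2
  have hne := right_ne_zero_of_mul hy
  have hn1 := left_ne_zero_of_mul hne
  have hn2 := right_ne_zero_of_mul hne
  generalize (1 + lam p q r (circ z.1 / 4) / (circ z.2 / 2)) ^ (1 / 2 : ℂ) = A at *
  generalize (1 + circ z.2 / 2) ^ (1 / 2 : ℂ) = B at *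
  field_simp
  linear_combination (-4 * Real.pi ^ 2 * circ z.1 ^ 3 * circ z.2 : ℂ) * Complex.I_sq

/-- The torus as a chain with one square. -/
noncomputable def torusChain (s : ℂ × ℂ × ℂ) : SquareChain 1 where
  coeff := fun _ => 1
  cube := fun _ => torus s.1 s.2.1 s.2.2

/-- Opposite sides of the square have the same image, so that the boundary vanishes identically. -/
theorem boundary_torusChain (s : ℂ × ℂ × ℂ) : (torusChain s).boundary = 0 := by
  simp [SquareChain.boundary, torusChain, torus]

theorem isCycleFamily_torusChain : IsCycleFamily smallParams torusChain where
  isCycle s hs :=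
    { smooth := fun _ => contDiff_torus hs
      mapsTo := fun _ z _ => (torus_mem_surface hs z).1
      boundary_mem := by
        rw [boundary_torusChain]
        exact zero_mem _ }
  coeff_eq _ _ _ _ := rfl
  continuousOn _ := continuousOn_torus

/-- The mean of `(1 + λ/u)^(-1/2) (1 + u)^(-1/2)` over the torus is the triple series: the monomial
`t ^ a * p ^ l * (q/t) ^ m * (r/t²) ^ n` of a power of `λ` has trivial exponent of `t` exactly when
`a = m + 2 n`. -/
theorem hasSum_series {p q r : ℂ} (h : (p, q, r) ∈ smallParams) :
    HasSum (fun e : ℕ × ℕ × ℕ =>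
        seriesCoeff e.1 e.2.1 e.2.2 * p ^ e.1 * q ^ e.2.1 * r ^ e.2.2)
      (∫ z in unitSquare,
        (1 + lam p q r (circ z.1 / 4) / (circ z.2 / 2)) ^ (-1 / 2 : ℂ) *
          (1 + circ z.2 / 2) ^ (-1 / 2 : ℂ)) := by
  have h' : ‖p‖ + 4 * ‖q‖ + 16 * ‖r‖ < 1 / 4 := h
  have H := hasSum_integral_torus ![1 / 4, p, 4 * q, 16 * r] ![1, 0, -1, -2] (by
    simp [Fin.sum_univ_four]
    linarith)
  have hlam (s : ℝ) : ∑ i, (![1 / 4, p, 4 * q, 16 * r] : Fin 4 → ℂ) i *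
      circ s ^ (![1, 0, -1, -2] : Fin 4 → ℤ) i = lam p q r (circ s / 4) := by
    have := circ_ne_zero s
    simp only [Fin.sum_univ_four, Matrix.cons_val, lam, zpow_one, zpow_zero, zpow_neg]
    norm_cast
    field_simp
    norm_num
  simp only [hlam] at H
  have hinj : Function.Injective fun e : ℕ × ℕ × ℕ =>
      (![e.2.1 + 2 * e.2.2, e.1, e.2.1, e.2.2] : Fin 4 → ℕ) := by
    rintro ⟨l, m, n⟩ ⟨l', m', n'⟩ he
    have h1 := congrFun he 1
    have h2 := congrFun he 2
    have h3 := congrFun he 3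
    simp only [Matrix.cons_val] at h1 h2 h3
    simp [h1, h2, h3]
  rw [← hinj.hasSum_iff] at H
  · refine Eq.mp (congrArg (HasSum · _) (funext fun e => ?_)) H
    obtain ⟨l, m, n⟩ := e
    rw [Function.comp, if_pos (by simp [Fin.sum_univ_four]), ← seriesCoeff_eq]
    simp only [Fin.prod_univ_four, Matrix.cons_val]
    -- The powers of the radius `1/4` of the circle cancel.
    have h4 : (1 / 4 : ℂ) ^ (m + 2 * n) * 4 ^ m * 16 ^ n = 1 := by
      rw [pow_add, pow_mul, mul_right_comm _ _ ((4 : ℂ) ^ m), ← mul_pow, mul_assoc, ← mul_pow]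
      norm_num
    simp only [mul_pow]
    linear_combination (seriesCoeff l m n * p ^ l * q ^ m * r ^ n) * h4
  · intro k hk
    refine if_neg fun h0 => hk ⟨(k 1, k 2, k 3), ?_⟩
    simp only [Fin.sum_univ_four, Matrix.cons_val] at h0
    funext i
    fin_cases i
    · simp
      omega
    all_goals simp

theorem integral_torusChain {p q r : ℂ} (h : (p, q, r) ∈ smallParams) :
    (torusChain (p, q, r)).integral p q r = 4 * Real.pi ^ 2 * ∫ z in unitSquare,
      (1 + lam p q r (circ z.1 / 4) / (circ z.2 / 2)) ^ (-1 / 2 : ℂ) *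
        (1 + circ z.2 / 2) ^ (-1 / 2 : ℂ) := by
  simp only [SquareChain.integral, torusChain, omega_torus h, Finset.univ_unique,
    Finset.sum_singleton, Int.cast_one, one_mul]
  rw [MeasureTheory.integral_const_mul]

end KummerPeriod

/-- There are a neighbourhood `U` of the origin, a nonzero constant `c`, and a continuous family of
2-cycles `Δ` on the surfaces `K(p,q,r)`, `(p,q,r) ∈ U`, such that the period of `dx ∧ dt / y` on
`Δ (p,q,r)` is `c` times the (absolutely convergent) triple power series in `p, q, r`. -/
theorem proposition1p2 :
    ∃ U : Set (ℂ × ℂ × ℂ), IsOpen U ∧ (0 : ℂ × ℂ × ℂ) ∈ U ∧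
      ∃ c : ℂ, c ≠ 0 ∧
        ∃ (k : ℕ) (Δ : ℂ × ℂ × ℂ → KummerPeriod.SquareChain k),
          KummerPeriod.IsCycleFamily U Δ ∧
          ∀ p q r : ℂ, (p, q, r) ∈ U →
            ∃ S : ℂ,
              HasSum (fun e : ℕ × ℕ × ℕ =>
                KummerPeriod.seriesCoeff e.1 e.2.1 e.2.2 * p ^ e.1 * q ^ e.2.1 * r ^ e.2.2) S ∧
              (Δ (p, q, r)).integral p q r = c * S := by
  refine ⟨KummerPeriod.smallParams, KummerPeriod.isOpen_smallParams, ?_,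
    4 * Real.pi ^ 2, by simp [Real.pi_ne_zero], 1, KummerPeriod.torusChain,
    KummerPeriod.isCycleFamily_torusChain, fun p q r h =>
      ⟨_, KummerPeriod.hasSum_series h, KummerPeriod.integral_torusChain h⟩⟩
  simp [KummerPeriod.smallParams]
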